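/- Soundness of movability flags. Fix exponent bounds $e_{\min},H\in\mathbb Z$, and for each precision $p\ge 1$ let $S_p\subset\mathbb R\cup\{\pm\infty\}$ be the finite set consisting of $0$, $\pm\infty$ and the numbers $\pm(1+s)2^h$ with $e_{\min}\le h\le H$ and $0\le s<1$ a multiple of $2^{1-p}$; thus $S_p\subseteq S_q$ for $p\le q$. Let $R_p^{\downarrow},R_p^{\uparrow}$ denote rounding down and up to $S_p$. An interval at precision $p$ is a pair $a\le b$ in $S_p$ with a flag on each endpoint saying whether that endpoint is immovable or movable. Write $[a',b']\prec[a,b]$ (the first interval refines the second) if ($b'=b$ and both are immovable, or $b'\le b$ and $b$ is movable) and ($a'=a$ and both are immovable, or $a'\ge a$ and $a$ is movable). Expressions are built from real constants, variables $x_1,\dots,x_n$ and operators. Their interval evaluation $[\![e]\!]_p(X_1,\dots,X_n)$ at precision $p$ on intervals $X_i$ sends $x_i$ to $X_i$ and a constant $c$ to $[R_p^{\downarrow}(c),R_p^{\uparrow}(c)]$, with both endpoints immovable if $c\in S_p$ and both movable otherwise. The evaluation $[\![e]\!]_p(x)$ on a point $x\in S_p^n$ uses $X_i=[x_i,x_i]$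 with both endpoints immovable. Operators are of the following kinds. (i) Any function $f:(\mathbb R\cup\{\pm\infty\})^k\to\mathbb R\cup\{\pm\infty\}$, evaluated as $[R_p^{\downarrow}(\inf f),R_p^{\uparrow}(\sup f)]$ over the box of the input intervals. The left endpoint is immovable exactly if (a) $f$ attains its minimum over the box at some point $w$ such that, for each $i$, $w_i$ is an immovable endpoint of the $i$-th interval or both endpoints of that interval are immovable, and $f(w)\in S_p$ or $f(w)<-2^{H+1}$; or (b) $f<-2^{H+1}$ on the whole box. The right endpoint is treated symmetrically, with the maximum and $f>2^{H+1}$. (ii) Addition, $[a_1,b_1]+[a_2,b_2]=[R_p^{\downarrow}(a_1+a_2),R_p^{\uparrow}(b_1+b_2)]$, where $-\infty$ dominates in the left sum and $+\infty$ in the right sum. The right endpoint is immovable exactly if $b_1,b_2$ are both immovable and $b_1+b_2$ is in $S_p$ or exceeds $2^{H+1}$, or $a_1+a_2>2^{H+1}$, or some $b_i$ is an immovable $+\infty$. The left endpoint is treated symmetrically. (iii) Multiplication (with $0\cdot(\pm\infty)=0$), evaluated as in (i). An endpoint is immovable exactly if it is so by the rule in (i), or if the corresponding extremum is attained at a point of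 the box one of whose coordinates is an immovable endpoint of its interval that is $0$, or that is $\pm\infty$ while the other interval does not contain $0$. (iv) Any further interval operators $F$ that preserve refinement: $F_q(I_1',\dots,I_k')\prec F_p(I_1,\dots,I_k)$ whenever $1\le p<q$, the $I_i$ are intervals at precision $p$, the $I_i'$ are intervals at precision $q$, and $I_i'\prec I_i$ for all $i$. Then for every expression $e$ and all precisions $q>p\ge 1$, $[\![e]\!]_q(x)\prec[\![e]\!]_p(x)$ for every input point $x\in S_t^n$ with $1\le t\le p$. More generally, $[\![e]\!]_q(X')\prec[\![e]\!]_p(X)$ for all tuples of intervals $X$ at precision $p$ and $X'$ at precision $q$ with $X_i'\prec X_i$ for all $i$. -/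

import Mathlib

/-- The exponent range of an arbitrary-precision floating-point library. It is the same at every
precision; `emax` is the largest exponent of a finite value. -/
structure ExponentRange where
  emin : ℤ
  emax : ℤ

namespace ExponentRange

/-- The extended reals representable with `p` significant bits: the two infinities, zero, and the
values `± (1 + s) * 2 ^ h` with `emin ≤ h ≤ emax`, where `1 + s = |m| / 2 ^ (p - 1)` lies in
`[1, 2)`. -/
def floats (R : ExponentRange) (p : ℕ) : Set EReal :=
  {x | x = ⊥ ∨ x = ⊤ ∨ x = 0 ∨
    ∃ m h : ℤ, 2 ^ p ≤ 2 * |m| ∧ |m| < 2 ^ p ∧ R.emin ≤ h ∧ h ≤ R.emax ∧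
      x = (((m : ℝ) * (2 : ℝ) ^ (h + 1 - (p : ℤ)) : ℝ) : EReal)}

/-- The overflow threshold: finite representable values have magnitude below it, whatever the
precision. -/
noncomputable def threshold (R : ExponentRange) : EReal :=
  (((2 : ℝ) ^ (R.emax + 1) : ℝ) : EReal)

/-- Rounding down: the largest representable value that is at most `x`. -/
noncomputable def roundDown (R : ExponentRange) (p : ℕ) (x : EReal) : EReal :=
  sSup {y | y ∈ R.floats p ∧ y ≤ x}

/-- Rounding up: the smallest representable value that is at least `x`. -/
noncomputable def roundUp (R : ExponentRange) (p : ℕ) (x : EReal) : EReal :=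
  sInf {y | y ∈ R.floats p ∧ x ≤ y}

theorem floats_finite (R : ExponentRange) (p : ℕ) : (R.floats p).Finite := by
  have h1 : (((Set.Icc (-(2 ^ p : ℤ)) (2 ^ p)) ×ˢ (Set.Icc R.emin R.emax)).image
      (fun a : ℤ × ℤ =>
        ((((a.1 : ℝ) * (2 : ℝ) ^ (a.2 + 1 - (p : ℤ)) : ℝ)) : EReal))).Finite :=
    ((Set.finite_Icc _ _).prod (Set.finite_Icc _ _)).image _
  refine (h1.union (Set.toFinite {⊥, ⊤, 0})).subset ?_
  rintro x (rfl | rfl | rfl | ⟨m, h, -, hm, h3, h4, rfl⟩)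
  · simp
  · simp
  · simp
  · left
    refine ⟨(m, h), ⟨?_, h3, h4⟩, rfl⟩
    have := abs_lt.mp hm
    exact ⟨this.1.le, this.2.le⟩

theorem roundDown_mem (R : ExponentRange) (p : ℕ) (x : EReal) :
    R.roundDown p x ∈ R.floats p ∧ R.roundDown p x ≤ x := by
  have hne : {y | y ∈ R.floats p ∧ y ≤ x}.Nonempty := ⟨⊥, Or.inl rfl, bot_le⟩
  exact hne.csSup_mem ((R.floats_finite p).subset fun y hy => hy.1)

theorem roundUp_mem (R : ExponentRange) (p : ℕ) (x : EReal) :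
    R.roundUp p x ∈ R.floats p ∧ x ≤ R.roundUp p x := by
  have hne : {y | y ∈ R.floats p ∧ x ≤ y}.Nonempty := ⟨⊤, Or.inr (Or.inl rfl), le_top⟩
  exact hne.csInf_mem ((R.floats_finite p).subset fun y hy => hy.1)

theorem floats_mono (R : ExponentRange) {p q : ℕ} (h : p ≤ q) : R.floats p ⊆ R.floats q := by
  rintro x (hx | hx | hx | ⟨m, e, h1, h2, h3, h4, rfl⟩)
  · exact Or.inl hx
  · exact Or.inr (Or.inl hx)
  · exact Or.inr (Or.inr (Or.inl hx))
  · obtain ⟨d, rfl⟩ := Nat.exists_eq_add_of_le h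
    refine Or.inr (Or.inr (Or.inr ⟨m * 2 ^ d, e, ?_, ?_, h3, h4, ?_⟩))
    · rw [abs_mul, abs_of_pos (by positivity : (0 : ℤ) < 2 ^ d), pow_add, ← mul_assoc]
      exact mul_le_mul_of_nonneg_right h1 (by positivity)
    · rw [abs_mul, abs_of_pos (by positivity : (0 : ℤ) < 2 ^ d), pow_add]
      exact mul_lt_mul_of_pos_right h2 (by positivity)
    · congr 1
      have : e + 1 - ((p + d : ℕ) : ℤ) = (e + 1 - (p : ℤ)) - (d : ℤ) := by push_cast; ring
      rw [this, zpow_sub₀ (by norm_num : (2 : ℝ) ≠ 0) (e + 1 - (p : ℤ)), zpow_natCast]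
      push_cast
      field_simp

end ExponentRange

/-- An interval at precision `p`, with a movability flag on each endpoint: the endpoint is
immovable when its flag (`loFixed`, `hiFixed`) is set, and movable otherwise. -/
structure MovInterval (R : ExponentRange) (p : ℕ) where
  lo : EReal
  hi : EReal
  loFixed : Prop
  hiFixed : Prop
  lo_mem : lo ∈ R.floats p
  hi_mem : hi ∈ R.floats p
  le : lo ≤ hi

namespace MovInterval

variable {R : ExponentRange}

/-- `J.Refines I`: an immovable endpoint of `I` is kept, with its flag, and a movable endpoint of
`I` can only move inward. -/
def Refines {p q : ℕ} (J : MovInterval R q) (I : MovInterval R p) : Prop :=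
  ((J.hi = I.hi ∧ J.hiFixed ∧ I.hiFixed) ∨ (J.hi ≤ I.hi ∧ ¬ I.hiFixed)) ∧
  ((J.lo = I.lo ∧ J.loFixed ∧ I.loFixed) ∨ (I.lo ≤ J.lo ∧ ¬ I.loFixed))

/-- The interval of a program input: both endpoints are immovable. -/
def point {p : ℕ} (x : EReal) (hx : x ∈ R.floats p) : MovInterval R p where
  lo := x
  hi := x
  loFixed := True
  hiFixed := True
  lo_mem := hx
  hi_mem := hx
  le := le_rfl

/-- The interval of a constant: rounded outward, and movable unless it is represented exactly. -/
noncomputable def const (p : ℕ) (c : ℝ) : MovInterval R p where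
  lo := R.roundDown p c
  hi := R.roundUp p c
  loFixed := (c : EReal) ∈ R.floats p
  hiFixed := (c : EReal) ∈ R.floats p
  lo_mem := (R.roundDown_mem p c).1
  hi_mem := (R.roundUp_mem p c).1
  le := (R.roundDown_mem p c).2.trans (R.roundUp_mem p c).2

/-- The set of points of a tuple of intervals. -/
def box {p k : ℕ} (I : Fin k → MovInterval R p) : Set (Fin k → EReal) :=
  {x | ∀ i, (I i).lo ≤ x i ∧ x i ≤ (I i).hi}

/-- `x` is an immovable endpoint of `I`. -/
def FixedEndpoint {p : ℕ} (I : MovInterval R p) (x : EReal) : Prop :=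
  (x = I.lo ∧ I.loFixed) ∨ (x = I.hi ∧ I.hiFixed)

/-- The coordinate `x` of a witness point belongs to every refinement of `I` because of the flags:
it is an immovable endpoint, or both endpoints are immovable. (Witness points are exact here.) -/
def Pinned {p : ℕ} (I : MovInterval R p) (x : EReal) : Prop :=
  FixedEndpoint I x ∨ (I.loFixed ∧ I.hiFixed)

/-- Propagation of immovability to the left endpoint of the interval version of `f`: `f` is
minimized at a witness point with pinned coordinates, where its value is representable or
overflows at every precision; or `f` overflows at every precision on all of the input. -/
def PropagatesLo {p k : ℕ} (f : (Fin k → EReal) → EReal) (I : Fin k → MovInterval R p) : Prop :=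
  (∃ x ∈ box I, IsMinOn f (box I) x ∧ (∀ i, Pinned (I i) (x i)) ∧
    (f x ∈ R.floats p ∨ f x < -R.threshold)) ∨
  ∀ x ∈ box I, f x < -R.threshold

/-- The same for the right endpoint. -/
def PropagatesHi {p k : ℕ} (f : (Fin k → EReal) → EReal) (I : Fin k → MovInterval R p) : Prop :=
  (∃ x ∈ box I, IsMaxOn f (box I) x ∧ (∀ i, Pinned (I i) (x i)) ∧
    (f x ∈ R.floats p ∨ R.threshold < f x)) ∨
  ∀ x ∈ box I, R.threshold < f x

theorem roundDown_sInf_le_roundUp_sSup {p k : ℕ} (f : (Fin k → EReal) → EReal)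
    (I : Fin k → MovInterval R p) :
    R.roundDown p (sInf (f '' box I)) ≤ R.roundUp p (sSup (f '' box I)) := by
  have hx : (fun i => (I i).lo) ∈ box I := fun i => ⟨le_rfl, (I i).le⟩
  have h := Set.mem_image_of_mem f hx
  exact ((R.roundDown_mem p _).2.trans (sInf_le h)).trans
    ((le_sSup h).trans (R.roundUp_mem p _).2)

/-- The correctly rounded interval version of a function `f` on the extended reals: the extreme
values of `f` on the input intervals, rounded outward. -/
noncomputable def apply {k : ℕ} (f : (Fin k → EReal) → EReal) (p : ℕ)
    (I : Fin k → MovInterval R p) : MovInterval R p where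
  lo := R.roundDown p (sInf (f '' box I))
  hi := R.roundUp p (sSup (f '' box I))
  loFixed := PropagatesLo f I
  hiFixed := PropagatesHi f I
  lo_mem := (R.roundDown_mem p _).1
  hi_mem := (R.roundUp_mem p _).1
  le := roundDown_sInf_le_roundUp_sSup f I

/-- Lower sum of two endpoints; `-∞` wins over `+∞`. -/
noncomputable def addLo (x y : EReal) : EReal := x + y

/-- Upper sum of two endpoints; `+∞` wins over `-∞`. -/
noncomputable def addHi (x y : EReal) : EReal := -(-x + -y)

theorem addLo_le_addHi {p : ℕ} (I J : MovInterval R p) :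
    addLo I.lo J.lo ≤ addHi I.hi J.hi := by
  have key : ∀ x y : EReal, x + y ≤ -(-x + -y) := by
    intro x y
    induction x <;> induction y <;> try simp
    rw [← EReal.coe_neg, ← EReal.coe_neg, ← EReal.coe_add, ← EReal.coe_add, ← EReal.coe_neg]
    exact EReal.coe_le_coe_iff.mpr (by linarith)
  exact (add_le_add I.le J.le).trans (key _ _)

/-- Interval addition. An immovable infinity of the sign that the endpoint can have makes the
endpoint immovable, whatever the other summand is. -/
noncomputable def add (p : ℕ) (I J : MovInterval R p) : MovInterval R p where
  lo := R.roundDown p (addLo I.lo J.lo)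
  hi := R.roundUp p (addHi I.hi J.hi)
  loFixed :=
    (I.loFixed ∧ J.loFixed ∧
      (addLo I.lo J.lo ∈ R.floats p ∨ addLo I.lo J.lo < -R.threshold)) ∨
    addHi I.hi J.hi < -R.threshold ∨
    (I.loFixed ∧ I.lo = ⊥) ∨ (J.loFixed ∧ J.lo = ⊥)
  hiFixed :=
    (I.hiFixed ∧ J.hiFixed ∧
      (addHi I.hi J.hi ∈ R.floats p ∨ R.threshold < addHi I.hi J.hi)) ∨
    R.threshold < addLo I.lo J.lo ∨
    (I.hiFixed ∧ I.hi = ⊤) ∨ (J.hiFixed ∧ J.hi = ⊤)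
  lo_mem := (R.roundDown_mem p _).1
  hi_mem := (R.roundUp_mem p _).1
  le := ((R.roundDown_mem p _).2.trans (addLo_le_addHi I J)).trans (R.roundUp_mem p _).2

/-- Multiplication of extended reals, with `0 * (± ∞) = 0`. -/
noncomputable def mulFun (x : Fin 2 → EReal) : EReal := x 0 * x 1

/-- The rules of multiplication at a witness point `x`: one factor is an immovable endpoint that
is zero, or that is infinite while the other interval does not contain zero. -/
def MulRule {p : ℕ} (I : Fin 2 → MovInterval R p) (x : Fin 2 → EReal) : Prop :=
  ∃ i j : Fin 2, i ≠ j ∧ FixedEndpoint (I i) (x i) ∧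
    (x i = 0 ∨ ((x i = ⊤ ∨ x i = ⊥) ∧ ¬ ((I j).lo ≤ 0 ∧ 0 ≤ (I j).hi)))

/-- Interval multiplication. -/
noncomputable def mul (p : ℕ) (I : Fin 2 → MovInterval R p) : MovInterval R p where
  lo := R.roundDown p (sInf (mulFun '' box I))
  hi := R.roundUp p (sSup (mulFun '' box I))
  loFixed := PropagatesLo mulFun I ∨
    ∃ x ∈ box I, IsMinOn mulFun (box I) x ∧ MulRule I x
  hiFixed := PropagatesHi mulFun I ∨
    ∃ x ∈ box I, IsMaxOn mulFun (box I) x ∧ MulRule I x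
  lo_mem := (R.roundDown_mem p _).1
  hi_mem := (R.roundUp_mem p _).1
  le := roundDown_sInf_le_roundUp_sSup mulFun I

end MovInterval

/-- A library of further interval operators, each implemented at every precision. -/
structure OperatorLibrary (R : ExponentRange) where
  Op : Type
  arity : Op → ℕ
  interval : (o : Op) → (p : ℕ) → (Fin (arity o) → MovInterval R p) → MovInterval R p

namespace OperatorLibrary

/-- The operator `o` preserves refinement of its inputs. -/
def PreservesRefinement {R : ExponentRange} (L : OperatorLibrary R) (o : L.Op) : Prop :=
  ∀ (p q : ℕ), 1 ≤ p → p < q →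
    ∀ (I : Fin (L.arity o) → MovInterval R p) (I' : Fin (L.arity o) → MovInterval R q),
      (∀ i, (I' i).Refines (I i)) → (L.interval o q I').Refines (L.interval o p I)

end OperatorLibrary

/-- Expressions in `n` variables: real constants, variables, sums, products, applications of
functions on the extended reals (`exp`, `sqrt`, `fabs`, `cos`, …; outside the domain of a partial
function the value is a convention, as the bounds carry no information there), and applications of
the operators of the library. -/
inductive IExpr {R : ExponentRange} (L : OperatorLibrary R) (n : ℕ) : Type where
  | const (c : ℝ) : IExpr L n
  | var (i : Fin n) : IExpr L n
  | add (a b : IExpr L n) : IExpr L n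
  | mul (a b : IExpr L n) : IExpr L n
  | app {k : ℕ} (f : (Fin k → EReal) → EReal) (args : Fin k → IExpr L n) : IExpr L n
  | op (o : L.Op) (args : Fin (L.arity o) → IExpr L n) : IExpr L n

namespace IExpr

/-- Interval evaluation at precision `p` on the input intervals `X`. -/
noncomputable def eval {R : ExponentRange} {L : OperatorLibrary R} {n : ℕ} (p : ℕ)
    (X : Fin n → MovInterval R p) : IExpr L n → MovInterval R p
  | const c => MovInterval.const p c
  | var i => X i
  | add a b => MovInterval.add p (eval p X a) (eval p X b)
  | mul a b => MovInterval.mul p ![eval p X a, eval p X b]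
  | app f args => MovInterval.apply f p fun i => eval p X (args i)
  | op o args => L.interval o p fun i => eval p X (args i)

/-- Interval evaluation at precision `p` on a program input `x` representable at precision `p`. -/
noncomputable def evalPoint {R : ExponentRange} {L : OperatorLibrary R} {n : ℕ} (p : ℕ)
    (x : Fin n → EReal) (hx : ∀ i, x i ∈ R.floats p) (e : IExpr L n) : MovInterval R p :=
  e.eval p fun i => MovInterval.point (x i) (hx i)

end IExpr

/-! Each operator preserves refinement, and induction on the expression (`IExpr.eval_refines`)
combines these facts. By `Refines.intro`, two claims are needed at each endpoint. Endpoints never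
move outward: the input boxes shrink, and because the sets of floats are nested, outward rounding
gets tighter as the precision grows. An immovable endpoint keeps its value and its flag, because the
certificate behind the flag survives refinement. A witness with pinned coordinates stays in the
smaller box and remains extremal there. Its value rounds the same way at both precisions, being
either representable or beyond a threshold independent of the precision
(`roundDown_eq_of_mem_or_lt`, `roundUp_eq_of_mem_or_lt`). For the special product rules the witness
itself may be lost, but `MulRule.refine` finds another with the same product. -/

namespace ExponentRange

variable {R : ExponentRange} {p q : ℕ} {x y : EReal}

/-! ### Rounding at two precisions -/

theorem roundDown_mono (h : p ≤ q) (hxy : x ≤ y) : R.roundDown p x ≤ R.roundDown q y :=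
  sSup_le_sSup fun _ hz => ⟨R.floats_mono h hz.1, hz.2.trans hxy⟩

theorem roundUp_anti_mono (h : p ≤ q) (hxy : x ≤ y) : R.roundUp q x ≤ R.roundUp p y :=
  sInf_le_sInf fun _ hz => ⟨R.floats_mono h hz.1, hxy.trans hz.2⟩

theorem roundDown_of_mem (hx : x ∈ R.floats p) : R.roundDown p x = x :=
  le_antisymm (R.roundDown_mem p x).2 (le_sSup ⟨hx, le_rfl⟩)

theorem roundUp_of_mem (hx : x ∈ R.floats p) : R.roundUp p x = x :=
  le_antisymm (sInf_le ⟨hx, le_rfl⟩) (R.roundUp_mem p x).2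

/-- The precision cancels between the bound on `m` and the scaling exponent, so one threshold serves
all precisions. -/
theorem abs_float_le_threshold {m h : ℤ} (hm : |m| < 2 ^ p) (hh : h ≤ R.emax) :
    |(m : ℝ) * (2 : ℝ) ^ (h + 1 - (p : ℤ))| ≤ (2 : ℝ) ^ (R.emax + 1) := by
  have hm' : |(m : ℝ)| ≤ 2 ^ p := by exact_mod_cast hm.le
  rw [abs_mul, abs_of_pos (by positivity : (0 : ℝ) < 2 ^ (h + 1 - (p : ℤ)))]
  calc |(m : ℝ)| * 2 ^ (h + 1 - (p : ℤ)) ≤ 2 ^ p * 2 ^ (h + 1 - (p : ℤ)) := by gcongr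
    _ = (2 : ℝ) ^ (h + 1) := by
      rw [← zpow_natCast, ← zpow_add₀ (by norm_num)]
      congr 1
      ring
    _ ≤ (2 : ℝ) ^ (R.emax + 1) := zpow_le_zpow_right₀ (by norm_num) (by lia)

theorem threshold_nonneg : 0 ≤ R.threshold := by
  unfold threshold
  exact EReal.coe_nonneg.mpr (by positivity)

theorem neg_threshold_le_of_mem (hx : x ∈ R.floats p) (h : x ≠ ⊥) : -R.threshold ≤ x := by
  rcases hx with rfl | rfl | rfl | ⟨m, e, -, hm, -, he, rfl⟩
  · exact absurd rfl h
  · exact le_top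
  · exact EReal.neg_le.mpr (by simpa using threshold_nonneg)
  · exact EReal.coe_le_coe_iff.mpr (neg_le_of_abs_le (abs_float_le_threshold hm he))

theorem le_threshold_of_mem (hx : x ∈ R.floats p) (h : x ≠ ⊤) : x ≤ R.threshold := by
  rcases hx with rfl | rfl | rfl | ⟨m, e, -, hm, -, he, rfl⟩
  · exact bot_le
  · exact absurd rfl h
  · exact threshold_nonneg
  · exact EReal.coe_le_coe_iff.mpr (le_of_abs_le (abs_float_le_threshold hm he))

/-- No float except `⊥` lies below the negated threshold, at any precision. -/
theorem roundDown_of_lt (hx : x < -R.threshold) : R.roundDown p x = ⊥ := by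
  by_contra h
  have hr := R.roundDown_mem p x
  exact absurd (neg_threshold_le_of_mem hr.1 h) (hr.2.trans_lt hx).not_ge

theorem roundUp_of_lt (hx : R.threshold < x) : R.roundUp p x = ⊤ := by
  by_contra h
  have hr := R.roundUp_mem p x
  exact absurd (le_threshold_of_mem hr.1 h) (hx.trans_le hr.2).not_ge

theorem roundDown_eq_of_mem_or_lt (h : p ≤ q) (hx : x ∈ R.floats p ∨ x < -R.threshold) :
    R.roundDown q x = R.roundDown p x := by
  rcases hx with hx | hx
  · rw [roundDown_of_mem hx, roundDown_of_mem (R.floats_mono h hx)]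
  · rw [roundDown_of_lt hx, roundDown_of_lt hx]

theorem roundUp_eq_of_mem_or_lt (h : p ≤ q) (hx : x ∈ R.floats p ∨ R.threshold < x) :
    R.roundUp q x = R.roundUp p x := by
  rcases hx with hx | hx
  · rw [roundUp_of_mem hx, roundUp_of_mem (R.floats_mono h hx)]
  · rw [roundUp_of_lt hx, roundUp_of_lt hx]

end ExponentRange

theorem IsMinOn.sInf_image_eq {α β : Type*} [CompleteLattice β] {f : α → β} {s : Set α} {x : α}
    (h : IsMinOn f s x) (hx : x ∈ s) : sInf (f '' s) = f x :=
  IsLeast.csInf_eq ⟨Set.mem_image_of_mem f hx, Set.forall_mem_image.mpr h⟩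

theorem IsMaxOn.sSup_image_eq {α β : Type*} [CompleteLattice β] {f : α → β} {s : Set α} {x : α}
    (h : IsMaxOn f s x) (hx : x ∈ s) : sSup (f '' s) = f x :=
  IsGreatest.csSup_eq ⟨Set.mem_image_of_mem f hx, Set.forall_mem_image.mpr h⟩

namespace MovInterval

open ExponentRange

variable {R : ExponentRange} {p q : ℕ}

/-! ### Endpoints and pinned points under refinement -/

namespace Refines

variable {J : MovInterval R q} {I : MovInterval R p} {x : EReal}

theorem hi_le (h : J.Refines I) : J.hi ≤ I.hi := by
  rcases h.1 with h | h
  · exact h.1.le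
  · exact h.1

theorem le_lo (h : J.Refines I) : I.lo ≤ J.lo := by
  rcases h.2 with h | h
  · exact h.1.ge
  · exact h.1

theorem hi_fixed (h : J.Refines I) (hI : I.hiFixed) : J.hi = I.hi ∧ J.hiFixed := by
  rcases h.1 with h | h
  · exact ⟨h.1, h.2.1⟩
  · exact absurd hI h.2

theorem lo_fixed (h : J.Refines I) (hI : I.loFixed) : J.lo = I.lo ∧ J.loFixed := by
  rcases h.2 with h | h
  · exact ⟨h.1, h.2.1⟩
  · exact absurd hI h.2

/-- Separates the monotonicity of the endpoints, which holds whatever the flags, from the stability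
of immovable ones. -/
theorem intro (hhi : J.hi ≤ I.hi) (hlo : I.lo ≤ J.lo)
    (hhi' : I.hiFixed → J.hi = I.hi ∧ J.hiFixed) (hlo' : I.loFixed → J.lo = I.lo ∧ J.loFixed) :
    J.Refines I := by
  unfold Refines
  tauto

theorem fixedEndpoint (h : J.Refines I) (hx : FixedEndpoint I x) : FixedEndpoint J x := by
  rcases hx with ⟨rfl, hf⟩ | ⟨rfl, hf⟩
  · exact Or.inl ⟨(h.lo_fixed hf).1.symm, (h.lo_fixed hf).2⟩
  · exact Or.inr ⟨(h.hi_fixed hf).1.symm, (h.hi_fixed hf).2⟩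

theorem pinned (h : J.Refines I) (hx : Pinned I x) : Pinned J x :=
  hx.imp h.fixedEndpoint fun hf => ⟨(h.lo_fixed hf.1).2, (h.hi_fixed hf.2).2⟩

end Refines

theorem FixedEndpoint.mem {I : MovInterval R p} {x : EReal} (hx : FixedEndpoint I x) :
    I.lo ≤ x ∧ x ≤ I.hi := by
  rcases hx with ⟨rfl, -⟩ | ⟨rfl, -⟩
  · exact ⟨le_rfl, I.le⟩
  · exact ⟨I.le, le_rfl⟩

/-- An immovable endpoint is still an endpoint of `J`; if both are immovable, the interval does not
shrink, so even interior points survive. -/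
theorem Refines.mem_of_pinned {J : MovInterval R q} {I : MovInterval R p} {x : EReal}
    (h : J.Refines I) (hx : Pinned I x) (hmem : I.lo ≤ x ∧ x ≤ I.hi) : J.lo ≤ x ∧ x ≤ J.hi := by
  rcases hx with hx | ⟨hl, hr⟩
  · exact (h.fixedEndpoint hx).mem
  · rwa [(h.lo_fixed hl).1, (h.hi_fixed hr).1]

theorem lo_mem_box {k : ℕ} (I : Fin k → MovInterval R p) : (fun i => (I i).lo) ∈ box I :=
  fun i => ⟨le_rfl, (I i).le⟩

/-! ### Functions on the extended reals -/

section Function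

variable {k : ℕ} {f : (Fin k → EReal) → EReal} {I : Fin k → MovInterval R p}
  {J : Fin k → MovInterval R q}

theorem box_subset (h : ∀ i, (J i).Refines (I i)) : box J ⊆ box I :=
  fun _ hx i => ⟨(h i).le_lo.trans (hx i).1, (hx i).2.trans (h i).hi_le⟩

theorem roundUp_sSup_le (hpq : p ≤ q) (h : ∀ i, (J i).Refines (I i)) :
    R.roundUp q (sSup (f '' box J)) ≤ R.roundUp p (sSup (f '' box I)) :=
  roundUp_anti_mono hpq (sSup_le_sSup (Set.image_mono (box_subset h)))

theorem le_roundDown_sInf (hpq : p ≤ q) (h : ∀ i, (J i).Refines (I i)) :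
    R.roundDown p (sInf (f '' box I)) ≤ R.roundDown q (sInf (f '' box J)) :=
  roundDown_mono hpq (sInf_le_sInf (Set.image_mono (box_subset h)))

/-- A minimizer over the large box that lies in the small one is a minimizer there too, so the two
infima agree before rounding. In the overflow case the infima may differ, but both round to `⊥`. -/
theorem PropagatesLo.refine (hpq : p ≤ q) (h : ∀ i, (J i).Refines (I i))
    (hf : PropagatesLo f I) :
    R.roundDown q (sInf (f '' box J)) = R.roundDown p (sInf (f '' box I)) ∧
      PropagatesLo f J := by
  rcases hf with ⟨x, hx, hmin, hpin, hval⟩ | hover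
  · have hxJ : x ∈ box J := fun i => (h i).mem_of_pinned (hpin i) (hx i)
    have hminJ : IsMinOn f (box J) x := hmin.on_subset (box_subset h)
    rw [hmin.sInf_image_eq hx, hminJ.sInf_image_eq hxJ]
    exact ⟨roundDown_eq_of_mem_or_lt hpq hval, Or.inl ⟨x, hxJ, hminJ,
      fun i => (h i).pinned (hpin i), hval.imp_left fun hv => R.floats_mono hpq hv⟩⟩
  · have hJ : ∀ x ∈ box J, f x < -R.threshold := fun x hx => hover x (box_subset h hx)
    -- The infimum need not be attained; the corner of left endpoints already forces it strictly
    -- below the threshold. Stated for any precision so as to apply to both boxes.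
    have hlt : ∀ {r : ℕ} {K : Fin k → MovInterval R r}, (∀ x ∈ box K, f x < -R.threshold) →
        sInf (f '' box K) < -R.threshold := fun {_ K} hK =>
      (sInf_le (Set.mem_image_of_mem f (lo_mem_box K))).trans_lt (hK _ (lo_mem_box K))
    exact ⟨by rw [roundDown_of_lt (hlt hJ), roundDown_of_lt (hlt hover)], Or.inr hJ⟩

theorem PropagatesHi.refine (hpq : p ≤ q) (h : ∀ i, (J i).Refines (I i))
    (hf : PropagatesHi f I) :
    R.roundUp q (sSup (f '' box J)) = R.roundUp p (sSup (f '' box I)) ∧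
      PropagatesHi f J := by
  rcases hf with ⟨x, hx, hmax, hpin, hval⟩ | hover
  · have hxJ : x ∈ box J := fun i => (h i).mem_of_pinned (hpin i) (hx i)
    have hmaxJ : IsMaxOn f (box J) x := hmax.on_subset (box_subset h)
    rw [hmax.sSup_image_eq hx, hmaxJ.sSup_image_eq hxJ]
    exact ⟨roundUp_eq_of_mem_or_lt hpq hval, Or.inl ⟨x, hxJ, hmaxJ,
      fun i => (h i).pinned (hpin i), hval.imp_left fun hv => R.floats_mono hpq hv⟩⟩
  · have hJ : ∀ x ∈ box J, R.threshold < f x := fun x hx => hover x (box_subset h hx)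
    have hlt : ∀ {r : ℕ} {K : Fin k → MovInterval R r}, (∀ x ∈ box K, R.threshold < f x) →
        R.threshold < sSup (f '' box K) := fun {_ K} hK =>
      (hK _ (lo_mem_box K)).trans_le (le_sSup (Set.mem_image_of_mem f (lo_mem_box K)))
    exact ⟨by rw [roundUp_of_lt (hlt hJ), roundUp_of_lt (hlt hover)], Or.inr hJ⟩

theorem apply_refines (hpq : p ≤ q) (h : ∀ i, (J i).Refines (I i)) :
    (apply f q J).Refines (apply f p I) :=
  .intro (roundUp_sSup_le hpq h) (le_roundDown_sInf hpq h)
    (PropagatesHi.refine hpq h) (PropagatesLo.refine hpq h)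

end Function

/-! ### Constants, input points and addition -/

theorem const_refines (hpq : p ≤ q) (c : ℝ) : (const q c : MovInterval R q).Refines (const p c) :=
  .intro (roundUp_anti_mono hpq le_rfl) (roundDown_mono hpq le_rfl)
    (fun hc => ⟨roundUp_eq_of_mem_or_lt hpq (Or.inl hc), R.floats_mono hpq hc⟩)
    (fun hc => ⟨roundDown_eq_of_mem_or_lt hpq (Or.inl hc), R.floats_mono hpq hc⟩)

theorem point_refines {x : EReal} (hp : x ∈ R.floats p) (hq : x ∈ R.floats q) :
    (point x hq).Refines (point x hp) :=
  .intro le_rfl le_rfl (fun _ => ⟨rfl, trivial⟩) (fun _ => ⟨rfl, trivial⟩)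

theorem addHi_mono {a b c d : EReal} (h₁ : a ≤ b) (h₂ : c ≤ d) : addHi a c ≤ addHi b d :=
  EReal.neg_le_neg_iff.mpr
    (add_le_add (EReal.neg_le_neg_iff.mpr h₁) (EReal.neg_le_neg_iff.mpr h₂))

theorem add_refines (hpq : p ≤ q) {I₁ I₂ : MovInterval R p} {J₁ J₂ : MovInterval R q}
    (h₁ : J₁.Refines I₁) (h₂ : J₂.Refines I₂) : (add q J₁ J₂).Refines (add p I₁ I₂) := by
  have hhi : addHi J₁.hi J₂.hi ≤ addHi I₁.hi I₂.hi := addHi_mono h₁.hi_le h₂.hi_le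
  have hlo : addLo I₁.lo I₂.lo ≤ addLo J₁.lo J₂.lo := add_le_add h₁.le_lo h₂.le_lo
  refine .intro (roundUp_anti_mono hpq hhi) (roundDown_mono hpq hlo) ?_ ?_
  · rintro (⟨hf₁, hf₂, hv⟩ | hv | ⟨hf, hv⟩ | ⟨hf, hv⟩)
    · obtain ⟨e₁, f₁⟩ := h₁.hi_fixed hf₁
      obtain ⟨e₂, f₂⟩ := h₂.hi_fixed hf₂
      simp only [add, e₁, e₂]
      exact ⟨roundUp_eq_of_mem_or_lt hpq hv,
        Or.inl ⟨f₁, f₂, hv.imp_left fun hm => R.floats_mono hpq hm⟩⟩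
    -- Overflow of the lower sums forces overflow of the upper sums, so both right endpoints round
    -- to `⊤` even if the summands move.
    · have hJ := hv.trans_le hlo
      refine ⟨?_, Or.inr (Or.inl hJ)⟩
      simp only [add]
      rw [roundUp_of_lt (hJ.trans_le (addLo_le_addHi _ _)),
        roundUp_of_lt (hv.trans_le (addLo_le_addHi _ _))]
    · obtain ⟨e, f⟩ := h₁.hi_fixed hf
      refine ⟨?_, Or.inr (Or.inr (Or.inl ⟨f, e.trans hv⟩))⟩
      -- In `addHi` a summand `⊤` absorbs the other one, which is therefore free to move.
      simp only [add, e, hv, addHi, EReal.neg_top, EReal.bot_add, EReal.neg_bot]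
      exact roundUp_eq_of_mem_or_lt hpq (Or.inl (Or.inr (Or.inl rfl)))
    · obtain ⟨e, f⟩ := h₂.hi_fixed hf
      refine ⟨?_, Or.inr (Or.inr (Or.inr ⟨f, e.trans hv⟩))⟩
      simp only [add, e, hv, addHi, EReal.neg_top, EReal.add_bot, EReal.neg_bot]
      exact roundUp_eq_of_mem_or_lt hpq (Or.inl (Or.inr (Or.inl rfl)))
  · rintro (⟨hf₁, hf₂, hv⟩ | hv | ⟨hf, hv⟩ | ⟨hf, hv⟩)
    · obtain ⟨e₁, f₁⟩ := h₁.lo_fixed hf₁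
      obtain ⟨e₂, f₂⟩ := h₂.lo_fixed hf₂
      simp only [add, e₁, e₂]
      exact ⟨roundDown_eq_of_mem_or_lt hpq hv,
        Or.inl ⟨f₁, f₂, hv.imp_left fun hm => R.floats_mono hpq hm⟩⟩
    · have hJ := hhi.trans_lt hv
      refine ⟨?_, Or.inr (Or.inl hJ)⟩
      simp only [add]
      rw [roundDown_of_lt ((addLo_le_addHi _ _).trans_lt hJ),
        roundDown_of_lt ((addLo_le_addHi _ _).trans_lt hv)]
    · obtain ⟨e, f⟩ := h₁.lo_fixed hf
      refine ⟨?_, Or.inr (Or.inr (Or.inl ⟨f, e.trans hv⟩))⟩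
      simp only [add, e, hv, addLo, EReal.bot_add]
      exact roundDown_eq_of_mem_or_lt hpq (Or.inl (Or.inl rfl))
    · obtain ⟨e, f⟩ := h₂.lo_fixed hf
      refine ⟨?_, Or.inr (Or.inr (Or.inr ⟨f, e.trans hv⟩))⟩
      simp only [add, e, hv, addLo, EReal.add_bot]
      exact roundDown_eq_of_mem_or_lt hpq (Or.inl (Or.inl rfl))

/-! ### Multiplication -/

section Multiplication

variable {I : Fin 2 → MovInterval R p} {J : Fin 2 → MovInterval R q} {x : Fin 2 → EReal}

theorem mulFun_eq {i j : Fin 2} (hij : i ≠ j) (x : Fin 2 → EReal) : mulFun x = x i * x j := by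
  unfold mulFun
  fin_cases i <;> fin_cases j <;> first | exact absurd rfl hij | rfl | exact mul_comm _ _

/-- An infinite factor absorbs every factor of constant sign. -/
theorem mul_eq_mul_of_infinite {a b c l u : EReal} (ha : a = ⊤ ∨ a = ⊥) (h0 : ¬(l ≤ 0 ∧ 0 ≤ u))
    (hb : l ≤ b ∧ b ≤ u) (hc : l ≤ c ∧ c ≤ u) :
    a * b = a * c ∧ (a * b = ⊤ ∨ a * b = ⊥) := by
  rcases lt_or_ge 0 l with hl | hl
  · have hb' := hl.trans_le hb.1
    have hc' := hl.trans_le hc.1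
    rcases ha with rfl | rfl
    · simp [EReal.top_mul_of_pos, hb', hc']
    · simp [EReal.bot_mul_of_pos, hb', hc']
  · have hu : u < 0 := lt_of_not_ge fun hu => h0 ⟨hl, hu⟩
    have hb' := hb.2.trans_lt hu
    have hc' := hc.2.trans_lt hu
    rcases ha with rfl | rfl
    · simp [EReal.top_mul_of_neg, hb', hc']
    · simp [EReal.bot_mul_of_neg, hb', hc']

/-- The special rules of multiplication give a witness point in every refinement of the box, with
the same exact product. -/
theorem MulRule.refine (h : ∀ i, (J i).Refines (I i)) (hx : x ∈ box I) (hr : MulRule I x) :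
    mulFun x ∈ R.floats p ∧ ∃ y ∈ box J, mulFun y = mulFun x ∧ MulRule J y := by
  obtain ⟨i, j, hij, hfix, hcase⟩ := hr
  -- The coordinate `x j` may have left the refined interval; any point of `J j` can replace it, and
  -- the left endpoint is chosen.
  let y : Fin 2 → EReal := Function.update (fun k => (J k).lo) i (x i)
  have hyi : y i = x i := Function.update_self ..
  have hyj : y j = (J j).lo := Function.update_of_ne hij.symm ..
  have hfixJ : FixedEndpoint (J i) (y i) := hyi ▸ (h i).fixedEndpoint hfix
  have hy : y ∈ box J := by
    intro k
    by_cases hk : k = i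
    · subst hk
      exact hfixJ.mem
    · rw [show y k = (J k).lo from Function.update_of_ne hk ..]
      exact ⟨le_rfl, (J k).le⟩
  rw [mulFun_eq hij]
  rcases hcase with h0 | ⟨hinf, h0⟩
  · refine ⟨by simp [h0, floats], y, hy, by simp [mulFun_eq hij, hyi, h0],
      i, j, hij, hfixJ, Or.inl (hyi.trans h0)⟩
  -- Both `x j` and `y j` lie in the original interval `I j`, which excludes zero, so they have the
  -- same sign.
  · obtain ⟨heq, hval⟩ := mul_eq_mul_of_infinite hinf h0 (hx j) (box_subset h hy j)
    refine ⟨?_, y, hy, by rw [mulFun_eq hij, hyi, heq], i, j, hij, hfixJ, Or.inr ⟨by rwa [hyi],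
      fun hc => h0 ⟨(h j).le_lo.trans hc.1, hc.2.trans (h j).hi_le⟩⟩⟩
    rcases hval with hv | hv
    · exact Or.inr (Or.inl hv)
    · exact Or.inl hv

theorem mul_refines (hpq : p ≤ q) (h : ∀ i, (J i).Refines (I i)) :
    (mul q J).Refines (mul p I) := by
  refine .intro (roundUp_sSup_le hpq h) (le_roundDown_sInf hpq h) ?_ ?_
  · rintro (hf | ⟨x, hx, hmax, hr⟩)
    · exact (hf.refine hpq h).imp_right Or.inl
    · obtain ⟨hv, y, hy, hyx, hry⟩ := hr.refine h hx
      -- The new witness attains the maximum over the larger box, hence the maximum over the smaller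
      -- one.
      have hmaxJ : IsMaxOn mulFun (box J) y :=
        fun z hz => (hmax (box_subset h hz)).trans hyx.ge
      refine ⟨?_, Or.inr ⟨y, hy, hmaxJ, hry⟩⟩
      simp only [mul]
      rw [hmax.sSup_image_eq hx, hmaxJ.sSup_image_eq hy, hyx]
      exact roundUp_eq_of_mem_or_lt hpq (Or.inl hv)
  · rintro (hf | ⟨x, hx, hmin, hr⟩)
    · exact (hf.refine hpq h).imp_right Or.inl
    · obtain ⟨hv, y, hy, hyx, hry⟩ := hr.refine h hx
      have hminJ : IsMinOn mulFun (box J) y :=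
        fun z hz => hyx.le.trans (hmin (box_subset h hz))
      refine ⟨?_, Or.inr ⟨y, hy, hminJ, hry⟩⟩
      simp only [mul]
      rw [hmin.sInf_image_eq hx, hminJ.sInf_image_eq hy, hyx]
      exact roundDown_eq_of_mem_or_lt hpq (Or.inl hv)

end Multiplication

end MovInterval

/-! ### Induction on expressions -/

theorem IExpr.eval_refines {R : ExponentRange} {L : OperatorLibrary R}
    (hL : ∀ o : L.Op, L.PreservesRefinement o) {n p q : ℕ} (hp : 1 ≤ p) (hpq : p < q)
    {X : Fin n → MovInterval R p} {X' : Fin n → MovInterval R q}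
    (hX : ∀ i, (X' i).Refines (X i)) (e : IExpr L n) : (e.eval q X').Refines (e.eval p X) := by
  induction e with
  | const c => exact MovInterval.const_refines hpq.le c
  | var i => exact hX i
  | add a b iha ihb => exact MovInterval.add_refines hpq.le iha ihb
  | mul a b iha ihb => exact MovInterval.mul_refines hpq.le (Fin.forall_fin_two.mpr ⟨iha, ihb⟩)
  | app f args ih => exact MovInterval.apply_refines hpq.le ih
  | op o args ih => exact hL o p q hp hpq _ _ ih

theorem theorem1 (R : ExponentRange) (L : OperatorLibrary R)
    (hL : ∀ o : L.Op, L.PreservesRefinement o)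
    (n : ℕ) (e : IExpr L n) (p q : ℕ) (hp : 1 ≤ p) (hpq : p < q) :
    (∀ (t : ℕ) (htp : t ≤ p) (x : Fin n → EReal) (hx : ∀ i, x i ∈ R.floats t),
      (e.evalPoint q x fun i => R.floats_mono (htp.trans hpq.le) (hx i)).Refines
        (e.evalPoint p x fun i => R.floats_mono htp (hx i))) ∧
    (∀ (X : Fin n → MovInterval R p) (X' : Fin n → MovInterval R q),
      (∀ i, (X' i).Refines (X i)) → (e.eval q X').Refines (e.eval p X)) :=
  ⟨fun _ _ _ _ => IExpr.eval_refines hL hp hpq (fun _ => MovInterval.point_refines _ _) e,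
    fun _ _ hX => IExpr.eval_refines hL hp hpq hX e⟩
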